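/- Let $(Z_t)_{t\in\mathbb Z}=(X_t,Y_t)_{t\in\mathbb Z}$ be a strictly stationary process with values in a product of measurable spaces $\mathcal X\times\mathcal Y$, with $\beta$-mixing coefficients $$\beta(a)=\big\|\mathbb P_{-\infty:0,\,a:\infty}-\mathbb P_{-\infty:0}\otimes\mathbb P_{a:\infty}\big\|_{\mathrm{TV}},\qquad a\in\mathbb N,$$ where $\mathbb P_{-\infty:0,\,a:\infty}$ is the joint law of $(Z_t)_{t\le 0}$ and $(Z_t)_{t\ge a}$, $\mathbb P_{-\infty:0}$ and $\mathbb P_{a:\infty}$ are its marginals, and $\|P-Q\|_{\mathrm{TV}}=\sup_A|P(A)-Q(A)|$. Assume that the process is $\beta$-mixing, i.e. $\beta(a)\to0$ as $a\to\infty$. Split the sample $(X_i,Y_i)_{i=1}^n$, $n=n_{\mathrm{train}}+n_{\mathrm{cal}}+n_{\mathrm{test}}$, into consecutive index sets $I_{\mathrm{train}}=\{1,\dots,n_{\mathrm{train}}\}$, $I_{\mathrm{cal}}=\{n_{\mathrm{train}}+1,\dots,n_{\mathrm{train}}+n_{\mathrm{cal}}\}$ and $I_{\mathrm{test}}=\{n_{\mathrm{train}}+n_{\mathrm{cal}}+1,\dots,n\}$.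 Let $s:(\mathcal X\times\mathcal Y)^{n_{\mathrm{train}}+1}\to\mathbb R$ be measurable, put $\hat s_{\mathrm{train}}(x,y)=s\big((X_i,Y_i)_{i\in I_{\mathrm{train}}},(x,y)\big)$, and for $\alpha\in(0,1)$ let $$\hat q_{1-\alpha,\mathrm{cal}}=\inf\Big\{t\in\mathbb R:\tfrac1{n_{\mathrm{cal}}}\sum_{i\in I_{\mathrm{cal}}}\mathbf 1\{\hat s_{\mathrm{train}}(X_i,Y_i)\le t\}\ge1-\alpha\Big\},\qquad \mathcal C_{1-\alpha}(x)=\{y\in\mathcal Y:\hat s_{\mathrm{train}}(x,y)\le\hat q_{1-\alpha,\mathrm{cal}}\}.$$ Let $\delta_{\mathrm{cal}},\delta_{\mathrm{test}}\in(0,1)$, $\tilde\sigma(a)=\sqrt{\tfrac14+\tfrac2a\sum_{k=1}^{a-1}(a-k)\beta(k)}$, $$\varepsilon_{\mathrm{cal}}=\inf_{(a,m,r)\in\mathcal F_{\mathrm{cal}}}\Big\{\tilde\sigma(a)\sqrt{\tfrac{4}{n_{\mathrm{cal}}-r+1}L_{\mathrm{cal}}}+\tfrac1{3m}L_{\mathrm{cal}}+\tfrac{r-1}{n_{\mathrm{cal}}}\Big\},\quad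 L_{\mathrm{cal}}=\log\frac{4}{\delta_{\mathrm{cal}}-4(m-1)\beta(a)-\beta(r)},$$ $$\varepsilon_{\mathrm{test}}=\inf_{(a,m,u)\in\mathcal F_{\mathrm{test}}}\Big\{\tilde\sigma(a)\sqrt{\tfrac{4}{n_{\mathrm{test}}}L_{\mathrm{test}}}+\tfrac1{3m}L_{\mathrm{test}}+\tfrac{u}{n_{\mathrm{test}}}\Big\},\quad L_{\mathrm{test}}=\log\frac{4}{\delta_{\mathrm{test}}-4(m-1)\beta(a)-\beta(n_{\mathrm{cal}})},$$ where $$\mathcal F_{\mathrm{cal}}=\{(a,m,r)\in\mathbb N_{>0}^3:\ 2ma=n_{\mathrm{cal}}-r+1,\ \delta_{\mathrm{cal}}>4(m-1)\beta(a)+\beta(r)\},$$ $$\mathcal F_{\mathrm{test}}=\{(a,m,u)\in\mathbb N_{>0}^2\times\mathbb N_{\ge0}:\ u+2ma=n_{\mathrm{test}},\ \delta_{\mathrm{test}}>4(m-1)\beta(a)+\beta(n_{\mathrm{cal}})\},$$ and both sets are assumed non-empty (otherwise an infimum is $+\infty$ and nothing is claimed). Then, with $\eta=\varepsilon_{\mathrm{cal}}+\varepsilon_{\mathrm{test}}$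 and with $\mathbb P$ the law of the whole sample, training part included, $$\mathbb P\Big[\tfrac1{n_{\mathrm{test}}}\sum_{i\in I_{\mathrm{test}}}\mathbf 1\{Y_i\in\mathcal C_{1-\alpha}(X_i)\}\ \ge\ 1-\alpha-\eta\Big]\ \ge\ 1-\delta_{\mathrm{cal}}-\delta_{\mathrm{test}}.$$ -/

import Mathlib

open MeasureTheory Filter Topology

noncomputable section

namespace SplitCP

/-- Total variation distance `sup_A |P(A) - Q(A)|`, over measurable sets `A`. -/
def tvDist {E : Type*} [MeasurableSpace E] (P Q : Measure E) : ℝ :=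
  ⨆ A : {A : Set E // MeasurableSet A}, |P.real A.1 - Q.real A.1|

section Mixing

variable {Ω E : Type*} [MeasurableSpace Ω] [MeasurableSpace E]

/-- Strict stationarity: the law of the whole process is invariant under time shifts. -/
def IsStationary (μ : Measure Ω) (Z : ℤ → Ω → E) : Prop :=
  ∀ k : ℤ, μ.map (fun ω (t : ℤ) => Z (t + k) ω) = μ.map (fun ω (t : ℤ) => Z t ω)

/-- The past `(Z_t)_{t ≤ 0}` as a random element of a product space. -/
def past (Z : ℤ → Ω → E) (ω : Ω) : {t : ℤ // t ≤ 0} → E := fun t => Z t.1 ω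

/-- The future `(Z_t)_{t ≥ a}` as a random element of a product space. -/
def future (Z : ℤ → Ω → E) (a : ℕ) (ω : Ω) : {t : ℤ // (a : ℤ) ≤ t} → E := fun t => Z t.1 ω

/-- The coefficient `β(a) = ‖P_{-∞:0, a:∞} - P_{-∞:0} ⊗ P_{a:∞}‖_TV`. -/
def betaCoeff (μ : Measure Ω) (Z : ℤ → Ω → E) (a : ℕ) : ℝ :=
  tvDist (μ.map fun ω => (past Z ω, future Z a ω))
    ((μ.map (past Z)).prod (μ.map (future Z a)))

/-- The process is `β`-mixing: `β(a) → 0` as `a → ∞`. -/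
def IsBetaMixing (μ : Measure Ω) (Z : ℤ → Ω → E) : Prop :=
  Tendsto (betaCoeff μ Z) atTop (𝓝 0)

end Mixing

section Slack

/-- `σ̃(a) = √(1/4 + (2/a) ∑_{k=1}^{a-1} (a-k) β(k))`. -/
def sigmaTilde (β : ℕ → ℝ) (a : ℕ) : ℝ :=
  Real.sqrt (1 / 4 + 2 / (a : ℝ) * ∑ k ∈ Finset.Ico 1 a, ((a : ℝ) - (k : ℝ)) * β k)

/-- Admissible triples `(a, m, r)` for the calibration slack: positive integers with
`2ma = n_cal - r + 1` and `δ_cal > 4(m-1)β(a) + β(r)`. -/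
def calFeasible (β : ℕ → ℝ) (ncal : ℕ) (δ : ℝ) : Set (ℕ × ℕ × ℕ) :=
  {p | 0 < p.1 ∧ 0 < p.2.1 ∧ 0 < p.2.2 ∧ 2 * p.2.1 * p.1 + p.2.2 = ncal + 1 ∧
    4 * ((p.2.1 : ℝ) - 1) * β p.1 + β p.2.2 < δ}

/-- The quantity minimised in `ε_cal`. -/
def calBound (β : ℕ → ℝ) (ncal : ℕ) (δ : ℝ) (a m r : ℕ) : ℝ :=
  sigmaTilde β a * Real.sqrt (4 / ((ncal : ℝ) - (r : ℝ) + 1) *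
      Real.log (4 / (δ - 4 * ((m : ℝ) - 1) * β a - β r)))
    + 1 / (3 * (m : ℝ)) * Real.log (4 / (δ - 4 * ((m : ℝ) - 1) * β a - β r))
    + ((r : ℝ) - 1) / (ncal : ℝ)

/-- `ε_cal`: the infimum of the bound over the admissible triples. -/
def epsCal (β : ℕ → ℝ) (ncal : ℕ) (δ : ℝ) : ℝ :=
  sInf ((fun p : ℕ × ℕ × ℕ => calBound β ncal δ p.1 p.2.1 p.2.2) '' calFeasible β ncal δ)

/-- Admissible triples `(a, m, s)` for the test slack: `a, m` positive, `s ≥ 0`,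
`s + 2ma = n_test` and `δ_test > 4(m-1)β(a) + β(n_cal)`. -/
def testFeasible (β : ℕ → ℝ) (ncal ntest : ℕ) (δ : ℝ) : Set (ℕ × ℕ × ℕ) :=
  {p | 0 < p.1 ∧ 0 < p.2.1 ∧ p.2.2 + 2 * p.2.1 * p.1 = ntest ∧
    4 * ((p.2.1 : ℝ) - 1) * β p.1 + β ncal < δ}

/-- The quantity minimised in `ε_test`. -/
def testBound (β : ℕ → ℝ) (ncal ntest : ℕ) (δ : ℝ) (a m s : ℕ) : ℝ :=
  sigmaTilde β a * Real.sqrt (4 / (ntest : ℝ) *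
      Real.log (4 / (δ - 4 * ((m : ℝ) - 1) * β a - β ncal)))
    + 1 / (3 * (m : ℝ)) * Real.log (4 / (δ - 4 * ((m : ℝ) - 1) * β a - β ncal))
    + (s : ℝ) / (ntest : ℝ)

/-- `ε_test`: the infimum of the bound over the admissible triples. -/
def epsTest (β : ℕ → ℝ) (ncal ntest : ℕ) (δ : ℝ) : ℝ :=
  sInf ((fun p : ℕ × ℕ × ℕ => testBound β ncal ntest δ p.1 p.2.1 p.2.2) ''
    testFeasible β ncal ntest δ)

end Slack

section Conformal

variable {Ω 𝒳 𝒴 : Type*}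

/-- The training sample `(X_i, Y_i)`, `i = 1, …, n_train`. -/
def trainSample (X : ℤ → Ω → 𝒳) (Y : ℤ → Ω → 𝒴) (ntrain : ℕ) (ω : Ω) :
    Fin ntrain → 𝒳 × 𝒴 :=
  fun j => (X ((j : ℕ) + 1 : ℤ) ω, Y ((j : ℕ) + 1 : ℤ) ω)

/-- Calibration indices `n_train + 1, …, n_train + n_cal`. -/
def calIdx (ntrain ncal : ℕ) : Finset ℕ := Finset.Icc (ntrain + 1) (ntrain + ncal)

/-- Test indices `n_train + n_cal + 1, …, n_train + n_cal + n_test`. -/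
def testIdx (ntrain ncal ntest : ℕ) : Finset ℕ :=
  Finset.Icc (ntrain + ncal + 1) (ntrain + ncal + ntest)

/-- The trained score `ŝ_train(x, y) = s((X_i, Y_i)_{i ∈ I_train}, (x, y))`. -/
def trainedScore (X : ℤ → Ω → 𝒳) (Y : ℤ → Ω → 𝒴) (ntrain : ℕ)
    (s : (Fin ntrain → 𝒳 × 𝒴) → 𝒳 × 𝒴 → ℝ) (ω : Ω) (x : 𝒳) (y : 𝒴) : ℝ :=
  s (trainSample X Y ntrain ω) (x, y)

open Classical in
/-- The empirical quantile `q̂_{1-α,cal}` of the calibration scores. -/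
def calQuantile (X : ℤ → Ω → 𝒳) (Y : ℤ → Ω → 𝒴) (ntrain ncal : ℕ)
    (s : (Fin ntrain → 𝒳 × 𝒴) → 𝒳 × 𝒴 → ℝ) (α : ℝ) (ω : Ω) : ℝ :=
  sInf {t : ℝ | 1 - α ≤ 1 / (ncal : ℝ) * ∑ i ∈ calIdx ntrain ncal,
    if trainedScore X Y ntrain s ω (X i ω) (Y i ω) ≤ t then (1 : ℝ) else 0}

/-- The prediction set `C_{1-α}(x) = {y | ŝ_train(x, y) ≤ q̂_{1-α,cal}}`. -/
def predictionSet (X : ℤ → Ω → 𝒳) (Y : ℤ → Ω → 𝒴) (ntrain ncal : ℕ)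
    (s : (Fin ntrain → 𝒳 × 𝒴) → 𝒳 × 𝒴 → ℝ) (α : ℝ) (ω : Ω) (x : 𝒳) : Set 𝒴 :=
  {y | trainedScore X Y ntrain s ω x y ≤ calQuantile X Y ntrain ncal s α ω}

open Classical in
/-- The empirical test coverage `(1/n_test) ∑_{i ∈ I_test} 1{Y_i ∈ C_{1-α}(X_i)}`. -/
def testCoverage (X : ℤ → Ω → 𝒳) (Y : ℤ → Ω → 𝒴) (ntrain ncal ntest : ℕ)
    (s : (Fin ntrain → 𝒳 × 𝒴) → 𝒳 × 𝒴 → ℝ) (α : ℝ) (ω : Ω) : ℝ :=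
  1 / (ntest : ℝ) * ∑ i ∈ testIdx ntrain ncal ntest,
    if Y i ω ∈ predictionSet X Y ntrain ncal s α ω (X i ω) then (1 : ℝ) else 0

end Conformal

end SplitCP

end

/-!
A deviation bound is needed for the frequency with which the scores of a window of `2ma`
consecutive observations fall in a set depending on the training sample.

*Decoupling.* By stationarity, a functional of the process up to time `τ` and a functional of the
process from time `τ + g` on have a joint law within `β(g)` of the product of their laws
(`abs_real_pair_sub_prod_le_betaCoeff`). No regular conditional laws are involved, so the
observations may live in arbitrary measurable spaces.

*Bernstein's inequality.* The window is cut into `2m` blocks of length `a`. The means over every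
second block form a sequence whose next term is, up to `β(a)`, independent of the partial sum of the
preceding ones. Bounding `P(S + V ≥ c)` by an integral over the law of `V` and using the exponential
bound for `S` inside gives the Chernoff bound with an extra error `(m - 1) β(a)`
(`real_le_sum_le_of_almost_indep`). The block means have variance at most `σ̃(a)² / a`, since the
covariance of two indicators at distance `k` is at most `β(k)`. This is
`real_le_sum_centredHit_le`. Fubini's theorem extends it to random sets that depend on the training
sample, at the cost of `β` of the gap (`real_le_sum_indicator_sub_le`).

*Quantiles.* Both infima defining the slacks are attained, the admissible sets being finite. Let
`q` be the population quantile, given the training sample, of level `p = 1 - α - ε_cal`. If the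
calibration quantile were below `q`, at least a share `1 - α` of the calibration scores would be
below `q`, an event of probability at most `p` for an independent observation: a deviation of size
`ε_cal`, hence of probability at most `δ_cal`. Otherwise, only test points with score above `q` are
missed; their probability is at most `1 - p`, so outside an event of probability `δ_test` their
share is at most `1 - p + ε_test`. For `p ≤ 0` the claim is trivial. The up to `r - 1` calibration
and `u` test points outside the windows account for the last terms of the slacks.
-/

namespace SplitCP

/-! ### Total variation and decoupling of past and future -/

theorem abs_real_sub_real_le_tvDist {E : Type*} [MeasurableSpace E] (P Q : Measure E)
    [IsProbabilityMeasure P] [IsProbabilityMeasure Q] {A : Set E} (hA : MeasurableSet A) :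
    |P.real A - Q.real A| ≤ tvDist P Q := by
  refine le_ciSup (f := fun A : {A : Set E // MeasurableSet A} => |P.real A.1 - Q.real A.1|)
    ⟨1, ?_⟩ ⟨A, hA⟩
  rintro _ ⟨B, rfl⟩
  have h1 := measureReal_nonneg (μ := P) (s := B.1)
  have h2 := measureReal_nonneg (μ := Q) (s := B.1)
  have h3 := measureReal_le_one (μ := P) (s := B.1)
  have h4 := measureReal_le_one (μ := Q) (s := B.1)
  exact abs_le.2 ⟨by linarith, by linarith⟩

theorem tvDist_nonneg {E : Type*} [MeasurableSpace E] (P Q : Measure E) : 0 ≤ tvDist P Q :=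
  Real.iSup_nonneg fun _ => abs_nonneg _

section Decoupling

variable {Ω E : Type*} [MeasurableSpace Ω] [MeasurableSpace E] {μ : Measure Ω}
  {Z : ℤ → Ω → E}

theorem betaCoeff_nonneg (μ : Measure Ω) (Z : ℤ → Ω → E) (a : ℕ) : 0 ≤ betaCoeff μ Z a :=
  tvDist_nonneg _ _

/-- By stationarity, path functionals of the shifted process have the same law as those of the
original one. -/
theorem IsStationary.map_comp_shift (hstat : IsStationary μ Z) (hZ : ∀ t, Measurable (Z t))
    {S : Type*} [MeasurableSpace S] {Φ : (ℤ → E) → S} (hΦ : Measurable Φ) (k : ℤ) :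
    μ.map (fun ω => Φ fun t => Z (t + k) ω) = μ.map (fun ω => Φ fun t => Z t ω) := by
  have h1 : Measurable fun ω (t : ℤ) => Z (t + k) ω := measurable_pi_lambda _ fun t => hZ _
  have h2 : Measurable fun ω (t : ℤ) => Z t ω := measurable_pi_lambda _ fun t => hZ _
  have := congrArg (Measure.map Φ) (hstat k)
  rwa [Measure.map_map hΦ h1, Measure.map_map hΦ h2] at this

/-- A functional `U` of the process up to time `τ` and a functional `V` of the process from time
`τ + a` on are independent up to an error `β(a)`. Truncating the time index by `min` and `max`
expresses that `U` and `V` depend on the respective part of the path only. -/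
theorem abs_real_pair_sub_prod_le_betaCoeff [IsProbabilityMeasure μ]
    (hZ : ∀ t, Measurable (Z t)) (hstat : IsStationary μ Z) (τ : ℤ) (a : ℕ)
    {S T : Type*} [MeasurableSpace S] [MeasurableSpace T]
    {Φ : (ℤ → E) → S} (hΦ : Measurable Φ) {Ψ : (ℤ → E) → T} (hΨ : Measurable Ψ)
    {U : Ω → S} (hU : ∀ ω, U ω = Φ fun t => Z (min t τ) ω)
    {V : Ω → T} (hV : ∀ ω, V ω = Ψ fun t => Z (max t (τ + a)) ω)
    {A : Set (S × T)} (hA : MeasurableSet A) :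
    |μ.real {ω | (U ω, V ω) ∈ A} - ((μ.map U).prod (μ.map V)).real A| ≤ betaCoeff μ Z a := by
  set φ : ({t : ℤ // t ≤ 0} → E) → S :=
    fun p => Φ fun t => p ⟨min (t - τ) 0, min_le_right _ _⟩ with hφ
  set ψ : ({t : ℤ // (a : ℤ) ≤ t} → E) → T :=
    fun p => Ψ fun t => p ⟨max (t - τ) a, le_max_right _ _⟩ with hψ
  have hφm : Measurable φ := hΦ.comp (measurable_pi_lambda _ fun t => measurable_pi_apply _)
  have hψm : Measurable ψ := hΨ.comp (measurable_pi_lambda _ fun t => measurable_pi_apply _)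
  -- `φ` and `ψ` read `U` and `V` off the past and the future of the process shifted by `τ`.
  set Φ₀ : (ℤ → E) → S := fun z => φ fun t => z t.1
  set Ψ₀ : (ℤ → E) → T := fun z => ψ fun t => z t.1
  have hΦ₀ : Measurable Φ₀ := hφm.comp (g := φ)
    (measurable_pi_lambda (fun (z : ℤ → E) (t : {t : ℤ // t ≤ 0}) => z t.1)
      fun t => measurable_pi_apply _)
  have hΨ₀ : Measurable Ψ₀ := hψm.comp (g := ψ)
    (measurable_pi_lambda (fun (z : ℤ → E) (t : {t : ℤ // (a : ℤ) ≤ t}) => z t.1)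
      fun t => measurable_pi_apply _)
  have hU' : U = fun ω => Φ₀ fun t => Z (t + τ) ω := by
    funext ω
    rw [hU]
    simp only [Φ₀, hφ]
    congr 1; funext t; congr 2; omega
  have hV' : V = fun ω => Ψ₀ fun t => Z (t + τ) ω := by
    funext ω
    rw [hV]
    simp only [Ψ₀, hψ]
    congr 1; funext t; congr 2; omega
  have hpast : Measurable (past Z) := measurable_pi_lambda _ fun t => hZ _
  have hfut : Measurable (future Z a) := measurable_pi_lambda _ fun t => hZ _
  have hUm : μ.map U = (μ.map (past Z)).map φ := by
    rw [hU', hstat.map_comp_shift hZ hΦ₀, Measure.map_map hφm hpast]; rfl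
  have hVm : μ.map V = (μ.map (future Z a)).map ψ := by
    rw [hV', hstat.map_comp_shift hZ hΨ₀, Measure.map_map hψm hfut]; rfl
  have hUVm : μ.map (fun ω => (U ω, V ω)) =
      (μ.map fun ω => (past Z ω, future Z a ω)).map (Prod.map φ ψ) := by
    rw [hU', hV', hstat.map_comp_shift hZ (hΦ₀.prodMk hΨ₀),
      Measure.map_map (hφm.prodMap hψm) (hpast.prodMk hfut)]; rfl
  have hUmeas : Measurable U := by
    rw [hU']; exact hΦ₀.comp (measurable_pi_lambda (fun ω (t : ℤ) => Z (t + τ) ω) fun t => hZ _)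
  have hVmeas : Measurable V := by
    rw [hV']; exact hΨ₀.comp (measurable_pi_lambda (fun ω (t : ℤ) => Z (t + τ) ω) fun t => hZ _)
  have := Measure.isProbabilityMeasure_map (μ := μ) hpast.aemeasurable
  have := Measure.isProbabilityMeasure_map (μ := μ) hfut.aemeasurable
  have := Measure.isProbabilityMeasure_map (μ := μ) (hpast.prodMk hfut).aemeasurable
  have h1 : μ.real {ω | (U ω, V ω) ∈ A} =
      (μ.map fun ω => (past Z ω, future Z a ω)).real (Prod.map φ ψ ⁻¹' A) := by
    rw [← map_measureReal_apply (hφm.prodMap hψm) hA, ← hUVm,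
      map_measureReal_apply (hUmeas.prodMk hVmeas) hA]; rfl
  have h2 : ((μ.map U).prod (μ.map V)).real A =
      ((μ.map (past Z)).prod (μ.map (future Z a))).real (Prod.map φ ψ ⁻¹' A) := by
    rw [hUm, hVm, Measure.map_prod_map _ _ hφm hψm,
      map_measureReal_apply (hφm.prodMap hψm) hA]
  rw [h1, h2]
  exact abs_real_sub_real_le_tvDist _ _ (hφm.prodMap hψm hA)

end Decoupling

/-! ### A Bernstein inequality for weakly dependent sums -/

/-- Exponential bound for partial sums that are only approximately independent of the next summand:
it needs two-fold products of laws only, each of which costs an error `b`. -/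
theorem real_le_sum_le_of_almost_indep {Ω : Type*} [MeasurableSpace Ω] {μ : Measure Ω}
    [IsProbabilityMeasure μ] {V : ℕ → Ω → ℝ} (hV : ∀ j, Measurable (V j)) {ν : Measure ℝ}
    (hν : ∀ j, μ.map (V j) = ν) {b : ℝ}
    (hdep : ∀ m c, μ.real {ω | c ≤ ∑ j ∈ Finset.range (m + 1), V j ω + V (m + 1) ω} ≤
      ((μ.map fun ω => ∑ j ∈ Finset.range (m + 1), V j ω).prod ν).real {p | c ≤ p.1 + p.2} + b)
    {l M : ℝ} (hl : 0 ≤ l) (hint : Integrable (fun x => Real.exp (l * x)) ν)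
    (hM : ∫ x, Real.exp (l * x) ∂ν ≤ M) (m : ℕ) (c : ℝ) :
    μ.real {ω | c ≤ ∑ j ∈ Finset.range (m + 1), V j ω} ≤
      Real.exp (-(l * c)) * M ^ (m + 1) + m * b := by
  have hνp : IsProbabilityMeasure ν := by
    rw [← hν 0]; exact Measure.isProbabilityMeasure_map (hV 0).aemeasurable
  have hM0 : 0 ≤ M := (integral_nonneg fun _ => (Real.exp_pos _).le).trans hM
  induction m generalizing c with
  | zero =>
    have h := ProbabilityTheory.measure_ge_le_exp_mul_mgf (μ := ν) (X := id) c hl hint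
    have h0 : μ.real {ω | c ≤ ∑ j ∈ Finset.range (0 + 1), V j ω} = ν.real {x | c ≤ id x} := by
      rw [← hν 0, map_measureReal_apply (hV 0) (measurableSet_le measurable_const measurable_id)]
      simp
    rw [h0]
    refine h.trans ?_
    simp only [ProbabilityTheory.mgf, id, neg_mul, zero_add, pow_one, Nat.cast_zero, zero_mul,
      add_zero]
    gcongr
  | succ m ih =>
    have hSm : Measurable fun ω => ∑ j ∈ Finset.range (m + 1), V j ω := by fun_prop
    set ρ := μ.map fun ω => ∑ j ∈ Finset.range (m + 1), V j ω with hρ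
    have : IsProbabilityMeasure ρ := Measure.isProbabilityMeasure_map hSm.aemeasurable
    have hset : MeasurableSet {p : ℝ × ℝ | c ≤ p.1 + p.2} :=
      measurableSet_le measurable_const (by fun_prop)
    have hbound : (ρ.prod ν).real {p | c ≤ p.1 + p.2} ≤
        Real.exp (-(l * c)) * M ^ (m + 2) + m * b := by
      have hfub : (ρ.prod ν).real {p | c ≤ p.1 + p.2} = ∫ y, ρ.real {x | c ≤ x + y} ∂ν := by
        rw [measureReal_def, Measure.prod_apply_symm hset, ← integral_toReal]
        · rfl
        · exact (measurable_measure_prodMk_right hset).aemeasurable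
        · exact ae_of_all _ fun _ => measure_lt_top _ _
      have hsec : ∀ y, ρ.real {x | c ≤ x + y} ≤
          Real.exp (-(l * c)) * M ^ (m + 1) * Real.exp (l * y) + m * b := by
        intro y
        have h1 : ρ.real {x | c ≤ x + y} =
            μ.real {ω | c - y ≤ ∑ j ∈ Finset.range (m + 1), V j ω} := by
          rw [hρ, map_measureReal_apply hSm (measurableSet_le measurable_const (by fun_prop))]
          congr 1; ext ω; simp
        rw [h1]
        refine (ih (c - y)).trans (le_of_eq ?_)
        rw [show -(l * (c - y)) = -(l * c) + l * y by ring, Real.exp_add]; ring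
      have hint2 : Integrable
          (fun y => Real.exp (-(l * c)) * M ^ (m + 1) * Real.exp (l * y) + m * b) ν :=
        (hint.const_mul _).add (integrable_const _)
      rw [hfub]
      refine (integral_mono_of_nonneg (ae_of_all _ fun _ => measureReal_nonneg) hint2
        (ae_of_all _ hsec)).trans ?_
      rw [integral_add (hint.const_mul _) (integrable_const _), integral_const_mul,
        integral_const]
      simp only [probReal_univ, one_smul]
      have : Real.exp (-(l * c)) * M ^ (m + 1) * ∫ y, Real.exp (l * y) ∂ν ≤
          Real.exp (-(l * c)) * M ^ (m + 1) * M := by gcongr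
      calc _ ≤ Real.exp (-(l * c)) * M ^ (m + 1) * M + m * b := by linarith
        _ = _ := by ring
    have h := hdep m c
    simp only [Finset.sum_range_succ _ (m + 1)]
    push_cast
    linarith

/-- The scalar inequality behind Bernstein's bound on the moment generating function. -/
theorem exp_mul_le {u : ℝ} :
    (2 - 2 / 3 * u) * Real.exp u ≤ 2 + 4 / 3 * u + u ^ 2 / 3 := by
  -- The difference `g` of the two sides is convex, with `g 0 = g' 0 = 0`.
  set g : ℝ → ℝ := fun x => 2 + 4 / 3 * x + x ^ 2 / 3 - (2 - 2 / 3 * x) * Real.exp x with hg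
  set g' : ℝ → ℝ := fun x => 4 / 3 + 2 / 3 * x - (4 / 3 - 2 / 3 * x) * Real.exp x with hg'
  have hd : ∀ x, HasDerivAt g (g' x) x := by
    intro x
    have h1 : HasDerivAt (fun x : ℝ => 2 + 4 / 3 * x + x ^ 2 / 3) (4 / 3 + 2 / 3 * x) x := by
      have := (((hasDerivAt_id x).const_mul (4 / 3 : ℝ)).const_add 2).add
        (((hasDerivAt_id x).pow 2).div_const 3)
      exact this.congr_deriv (by simp; ring)
    have h2 := (((hasDerivAt_id x).const_mul (2 / 3 : ℝ)).const_sub 2).mul (Real.hasDerivAt_exp x)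
    exact (h1.sub h2).congr_deriv (by simp [hg']; ring)
  have hd' : ∀ x, HasDerivAt g' (2 / 3 - (2 / 3 - 2 / 3 * x) * Real.exp x) x := by
    intro x
    have h1 := ((hasDerivAt_id x).const_mul (2 / 3 : ℝ)).const_add (4 / 3)
    have h2 := (((hasDerivAt_id x).const_mul (2 / 3 : ℝ)).const_sub (4 / 3)).mul
      (Real.hasDerivAt_exp x)
    exact (h1.sub h2).congr_deriv (by simp; ring)
  have hmono : Monotone g' := by
    refine monotone_of_hasDerivAt_nonneg hd' fun x => ?_
    have h1 : 1 - x ≤ Real.exp (-x) := by linarith [Real.add_one_le_exp (-x)]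
    have h2 : (1 - x) * Real.exp x ≤ 1 := by
      calc _ ≤ Real.exp (-x) * Real.exp x := by gcongr
        _ = 1 := by rw [← Real.exp_add]; simp
    simp only [Pi.zero_apply]
    linarith
  have h0 : g' 0 = 0 := by simp [hg']
  have hg0 : g 0 = 0 := by simp [hg]
  have hgc : Differentiable ℝ g := fun x => (hd x).differentiableAt
  have hderiv : ∀ x, deriv g x = g' x := fun x => (hd x).deriv
  suffices 0 ≤ g u by simp only [hg] at this; linarith
  rcases le_total 0 u with hu | hu
  · have : MonotoneOn g (Set.Ici 0) := by
      refine monotoneOn_of_deriv_nonneg (convex_Ici 0) hgc.continuous.continuousOn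
        hgc.differentiableOn fun x hx => ?_
      rw [interior_Ici] at hx
      rw [hderiv, ← h0]; exact hmono (le_of_lt hx)
    rw [← hg0]; exact this Set.self_mem_Ici hu hu
  · have : AntitoneOn g (Set.Iic 0) := by
      refine antitoneOn_of_deriv_nonpos (convex_Iic 0) hgc.continuous.continuousOn
        hgc.differentiableOn fun x hx => ?_
      rw [interior_Iic] at hx
      rw [hderiv, ← h0]; exact hmono (le_of_lt hx)
    rw [← hg0]; exact this hu Set.self_mem_Iic hu

theorem exp_le_one_add_add_sq {u l : ℝ} (hul : u ≤ l) (hl : l < 3) :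
    Real.exp u ≤ 1 + u + u ^ 2 / (2 * (1 - l / 3)) := by
  have h1 : 0 < 1 - u / 3 := by linarith
  have h2 : Real.exp u ≤ 1 + u + u ^ 2 / (2 * (1 - u / 3)) := by
    have := exp_mul_le (u := u)
    have h3 : 1 + u + u ^ 2 / (2 * (1 - u / 3)) =
        (2 + 4 / 3 * u + u ^ 2 / 3) / (2 - 2 / 3 * u) := by
      have : (2 - 2 / 3 * u) ≠ 0 := by linarith
      have h5 : (3 - u) ≠ 0 := by linarith
      field_simp
      ring
    rw [h3, le_div_iff₀ (by linarith)]
    linarith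
  refine h2.trans ?_
  have : u ^ 2 / (2 * (1 - u / 3)) ≤ u ^ 2 / (2 * (1 - l / 3)) := by
    apply div_le_div_of_nonneg_left (sq_nonneg _) (by linarith) (by linarith)
  linarith

/-- Bernstein's bound on the moment generating function of a centred variable. -/
theorem integral_exp_mul_le {ν : Measure ℝ} [IsProbabilityMeasure ν] {v l : ℝ}
    (hb : ∀ᵐ x ∂ν, |x| ≤ 1) (hmean : ∫ x, x ∂ν = 0) (hvar : ∫ x, x ^ 2 ∂ν ≤ v)
    (hl0 : 0 ≤ l) (hl : l < 3) :
    Integrable (fun x => Real.exp (l * x)) ν ∧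
      ∫ x, Real.exp (l * x) ∂ν ≤ Real.exp (v * l ^ 2 / (2 * (1 - l / 3))) := by
  have hpt : ∀ᵐ x ∂ν, Real.exp (l * x) ≤ 1 + l * x + l ^ 2 / (2 * (1 - l / 3)) * x ^ 2 := by
    filter_upwards [hb] with x hx
    have hx1 : l * x ≤ l := by nlinarith [(abs_le.1 hx).2]
    refine (exp_le_one_add_add_sq hx1 hl).trans (le_of_eq ?_)
    rw [mul_pow]; ring
  have hi1 : Integrable (fun x : ℝ => x) ν :=
    Integrable.of_bound (C := 1) (by fun_prop) (by simpa using hb)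
  have hi2 : Integrable (fun x : ℝ => x ^ 2) ν := by
    refine Integrable.of_bound (C := 1) (by fun_prop) ?_
    filter_upwards [hb] with x hx
    rw [norm_pow, Real.norm_eq_abs]; exact pow_le_one₀ (abs_nonneg _) hx
  have hi3 : Integrable (fun x => Real.exp (l * x)) ν := by
    refine Integrable.of_bound (C := Real.exp l) (by fun_prop) ?_
    filter_upwards [hb] with x hx
    rw [Real.norm_eq_abs, Real.abs_exp]
    exact Real.exp_le_exp.2 (by nlinarith [(abs_le.1 hx).2])
  refine ⟨hi3, ?_⟩
  have hi4 : Integrable (fun x : ℝ => 1 + l * x) ν := (integrable_const _).add (hi1.const_mul _)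
  have hi5 : Integrable (fun x : ℝ => l ^ 2 / (2 * (1 - l / 3)) * x ^ 2) ν := hi2.const_mul _
  have hc : 0 ≤ l ^ 2 / (2 * (1 - l / 3)) :=
    div_nonneg (sq_nonneg _) (by linarith)
  calc ∫ x, Real.exp (l * x) ∂ν
      ≤ ∫ x, (1 + l * x + l ^ 2 / (2 * (1 - l / 3)) * x ^ 2) ∂ν :=
        integral_mono_ae hi3 (hi4.add hi5) hpt
    _ = 1 + l ^ 2 / (2 * (1 - l / 3)) * ∫ x, x ^ 2 ∂ν := by
        rw [integral_add hi4 hi5, integral_add (integrable_const _) (hi1.const_mul _),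
          integral_const_mul, integral_const_mul, hmean]
        simp
    _ ≤ v * l ^ 2 / (2 * (1 - l / 3)) + 1 := by
        have := mul_le_mul_of_nonneg_left hvar hc
        have h2 : l ^ 2 / (2 * (1 - l / 3)) * v = v * l ^ 2 / (2 * (1 - l / 3)) := by ring
        linarith
    _ ≤ _ := Real.add_one_le_exp _

/-- Optimising the exponent in Bernstein's inequality: some `l` turns the deviation
`√(2VL) + L/3` into the bound `exp (-L)`. -/
theorem exists_bernstein_exponent {V L : ℝ} (hV : 0 < V) (hL : 0 ≤ L) :
    ∃ l, 0 ≤ l ∧ l < 3 ∧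
      V * l ^ 2 / (2 * (1 - l / 3)) - l * (Real.sqrt (2 * V * L) + L / 3) = -L := by
  -- With `κ = √(2L/V)` the optimal exponent is `l = κ / (1 + κ/3)`, so that
  -- `1 - l/3 = 1 / (1 + κ/3)`.
  obtain ⟨κ, hκ0, hκ⟩ : ∃ κ : ℝ, 0 ≤ κ ∧ L = V * κ ^ 2 / 2 :=
    ⟨Real.sqrt (2 * L / V), Real.sqrt_nonneg _, by
      rw [Real.sq_sqrt (by positivity)]; field_simp⟩
  have hs : Real.sqrt (2 * V * L) = V * κ := by
    rw [hκ, show 2 * V * (V * κ ^ 2 / 2) = (V * κ) ^ 2 by ring, Real.sqrt_sq (by positivity)]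
  have h3 : (0 : ℝ) < 3 + κ := by linarith
  refine ⟨3 * κ / (3 + κ), by positivity, ?_, ?_⟩
  · rw [div_lt_iff₀ h3]; linarith
  · have h1 : 1 - 3 * κ / (3 + κ) / 3 = 3 / (3 + κ) := by field_simp; ring
    rw [hs, hκ, h1]
    field_simp
    ring

/-! ### Blocks of a stationary mixing process -/

section Blocks

variable {Ω E : Type*} [MeasurableSpace Ω]

/-- The centred indicator `1{Z_i ∈ B} - P(Z_0 ∈ B)`. -/
noncomputable def centredHit (μ : Measure Ω) (Z : ℤ → Ω → E) (B : Set E) (i : ℤ) (ω : Ω) : ℝ :=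
  B.indicator (fun _ => (1 : ℝ)) (Z i ω) - μ.real (Z 0 ⁻¹' B)

/-- The mean of the centred indicators over the block `s, …, s + a - 1`. -/
noncomputable def blockMean (μ : Measure Ω) (Z : ℤ → Ω → E) (B : Set E) (a : ℕ) (s : ℤ) (ω : Ω) :
    ℝ :=
  (∑ i ∈ Finset.range a, centredHit μ Z B (s + i) ω) / a

variable {μ : Measure Ω} {Z : ℤ → Ω → E} {B : Set E}

theorem abs_centredHit_le_one [IsProbabilityMeasure μ] (i : ℤ) (ω : Ω) :
    |centredHit μ Z B i ω| ≤ 1 := by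
  have h1 := measureReal_nonneg (μ := μ) (s := Z 0 ⁻¹' B)
  have h2 := measureReal_le_one (μ := μ) (s := Z 0 ⁻¹' B)
  by_cases h : Z i ω ∈ B <;> simp only [centredHit, h, Set.indicator_of_mem, not_false_eq_true,
    Set.indicator_of_notMem] <;> exact abs_le.2 ⟨by linarith, by linarith⟩

theorem abs_blockMean_le_one [IsProbabilityMeasure μ] (a : ℕ) (s : ℤ) (ω : Ω) :
    |blockMean μ Z B a s ω| ≤ 1 := by
  rw [blockMean, abs_div, Nat.abs_cast]
  refine div_le_one_of_le₀ ((Finset.abs_sum_le_sum_abs _ _).trans ?_) (Nat.cast_nonneg _)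
  calc _ ≤ ∑ i ∈ Finset.range a, (1 : ℝ) :=
        Finset.sum_le_sum fun i _ => abs_centredHit_le_one (s + i) ω
    _ = a := by simp

theorem sum_centredHit_eq_sum_blockMean {a : ℕ} (ha : 0 < a) (s : ℤ) (m : ℕ) (ω : Ω) :
    ∑ i ∈ Finset.range (2 * m * a), centredHit μ Z B (s + i) ω =
      a * (∑ j ∈ Finset.range m, blockMean μ Z B a (s + 2 * a * j) ω
        + ∑ j ∈ Finset.range m, blockMean μ Z B a (s + a + 2 * a * j) ω) := by
  have ha' : (a : ℝ) ≠ 0 := by exact_mod_cast ha.ne'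
  induction m with
  | zero => simp
  | succ m ih =>
    rw [show 2 * (m + 1) * a = 2 * m * a + a + a by ring, Finset.sum_range_add,
      Finset.sum_range_add, ih, Finset.sum_range_succ, Finset.sum_range_succ]
    simp only [blockMean]
    have h1 : ∀ x : ℕ, s + ((2 * m * a + x : ℕ) : ℤ) = s + 2 * a * m + x := by
      intro x; push_cast; ring
    have h2 : ∀ x : ℕ, s + ((2 * m * a + a + x : ℕ) : ℤ) = s + a + 2 * a * m + x := by
      intro x; push_cast; ring
    simp only [h1, h2]
    field_simp
    ring

variable [MeasurableSpace E]

theorem measurable_centredHit (hZ : ∀ t, Measurable (Z t)) (hB : MeasurableSet B) (i : ℤ) :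
    Measurable (centredHit μ Z B i) :=
  ((measurable_const.indicator hB).comp (hZ i)).sub_const _

theorem measurable_blockMean (hZ : ∀ t, Measurable (Z t)) (hB : MeasurableSet B) (a : ℕ) (s : ℤ) :
    Measurable (blockMean μ Z B a s) :=
  (Finset.measurable_fun_sum _ fun _ _ => measurable_centredHit hZ hB _).div_const _

theorem IsStationary.real_preimage_eq (hstat : IsStationary μ Z) (hZ : ∀ t, Measurable (Z t))
    (hB : MeasurableSet B) (i : ℤ) : μ.real (Z i ⁻¹' B) = μ.real (Z 0 ⁻¹' B) := by
  have h := hstat.map_comp_shift hZ (measurable_pi_apply (0 : ℤ)) i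
  simp only [zero_add] at h
  rw [← map_measureReal_apply (hZ i) hB, ← map_measureReal_apply (hZ 0) hB]
  exact congrArg (fun ρ : Measure E => ρ.real B) h

theorem integrable_centredHit_mul [IsProbabilityMeasure μ] (hZ : ∀ t, Measurable (Z t))
    (hB : MeasurableSet B) (i j : ℤ) :
    Integrable (fun ω => centredHit μ Z B i ω * centredHit μ Z B j ω) μ := by
  refine Integrable.of_bound (C := 1) ((measurable_centredHit hZ hB i).mul
    (measurable_centredHit hZ hB j)).aestronglyMeasurable (ae_of_all _ fun ω => ?_)
  rw [norm_mul, Real.norm_eq_abs, Real.norm_eq_abs]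
  exact mul_le_one₀ (abs_centredHit_le_one i ω) (abs_nonneg _) (abs_centredHit_le_one j ω)

theorem integral_centredHit [IsProbabilityMeasure μ] (hstat : IsStationary μ Z)
    (hZ : ∀ t, Measurable (Z t)) (hB : MeasurableSet B) (i : ℤ) :
    ∫ ω, centredHit μ Z B i ω ∂μ = 0 := by
  have h : ∀ ω, centredHit μ Z B i ω =
      (Z i ⁻¹' B).indicator (fun _ => (1 : ℝ)) ω - μ.real (Z 0 ⁻¹' B) := fun ω => rfl
  simp_rw [h]
  rw [integral_sub ((integrable_const _).indicator (hZ i hB)) (integrable_const _),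
    integral_indicator_const _ (hZ i hB), hstat.real_preimage_eq hZ hB i]
  simp

theorem integral_centredHit_mul [IsProbabilityMeasure μ] (hstat : IsStationary μ Z)
    (hZ : ∀ t, Measurable (Z t)) (hB : MeasurableSet B) (i j : ℤ) :
    ∫ ω, centredHit μ Z B i ω * centredHit μ Z B j ω ∂μ =
      μ.real (Z i ⁻¹' B ∩ Z j ⁻¹' B) - μ.real (Z 0 ⁻¹' B) ^ 2 := by
  set p := μ.real (Z 0 ⁻¹' B) with hp
  have h : ∀ ω, centredHit μ Z B i ω * centredHit μ Z B j ω =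
      (Z i ⁻¹' B ∩ Z j ⁻¹' B).indicator (fun _ => (1 : ℝ)) ω
        - p * (centredHit μ Z B i ω + centredHit μ Z B j ω) - p ^ 2 := by
    intro ω
    by_cases h1 : Z i ω ∈ B <;> by_cases h2 : Z j ω ∈ B <;>
      simp [centredHit, ← hp, Set.indicator, h1, h2] <;> ring
  have hi : ∀ i, Integrable (centredHit μ Z B i) μ := fun i =>
    Integrable.of_bound (C := 1) (measurable_centredHit hZ hB i).aestronglyMeasurable
      (ae_of_all _ fun ω => abs_centredHit_le_one i ω)
  have hm : MeasurableSet (Z i ⁻¹' B ∩ Z j ⁻¹' B) := (hZ i hB).inter (hZ j hB)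
  simp_rw [h]
  have hi1 : Integrable ((Z i ⁻¹' B ∩ Z j ⁻¹' B).indicator (fun _ => (1 : ℝ))) μ :=
    (integrable_const _).indicator hm
  have hi2 : Integrable (fun ω => p * (centredHit μ Z B i ω + centredHit μ Z B j ω)) μ :=
    ((hi i).add (hi j)).const_mul p
  have hi3 : Integrable (fun ω => (Z i ⁻¹' B ∩ Z j ⁻¹' B).indicator (fun _ => (1 : ℝ)) ω
      - p * (centredHit μ Z B i ω + centredHit μ Z B j ω)) μ := hi1.sub hi2
  rw [integral_sub hi3 (integrable_const _), integral_sub hi1 hi2, integral_const_mul,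
    integral_add (hi i) (hi j), integral_centredHit hstat hZ hB, integral_centredHit hstat hZ hB,
    integral_indicator_const _ hm]
  simp

theorem integral_centredHit_sq_le [IsProbabilityMeasure μ] (hstat : IsStationary μ Z)
    (hZ : ∀ t, Measurable (Z t)) (hB : MeasurableSet B) (i : ℤ) :
    ∫ ω, centredHit μ Z B i ω * centredHit μ Z B i ω ∂μ ≤ 1 / 4 := by
  rw [integral_centredHit_mul hstat hZ hB, Set.inter_self, hstat.real_preimage_eq hZ hB]
  nlinarith [sq_nonneg (μ.real (Z 0 ⁻¹' B) - 1 / 2)]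

theorem integral_centredHit_mul_le_betaCoeff [IsProbabilityMeasure μ] (hstat : IsStationary μ Z)
    (hZ : ∀ t, Measurable (Z t)) (hB : MeasurableSet B) (i : ℤ) (k : ℕ) :
    ∫ ω, centredHit μ Z B i ω * centredHit μ Z B (i + k) ω ∂μ ≤ betaCoeff μ Z k := by
  rw [integral_centredHit_mul hstat hZ hB]
  have h := abs_real_pair_sub_prod_le_betaCoeff hZ hstat i k
    (measurable_pi_apply (i : ℤ)) (measurable_pi_apply (i + k : ℤ))
    (U := Z i) (fun ω => by simp) (V := Z (i + k)) (fun ω => by simp) (hB.prod hB)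
  rw [measureReal_prod_prod, map_measureReal_apply (hZ _) hB, map_measureReal_apply (hZ _) hB,
    hstat.real_preimage_eq hZ hB i, hstat.real_preimage_eq hZ hB (i + k), ← sq] at h
  exact (le_abs_self _).trans h

theorem integral_sum_centredHit_sq_le [IsProbabilityMeasure μ] (hstat : IsStationary μ Z)
    (hZ : ∀ t, Measurable (Z t)) (hB : MeasurableSet B) (s : ℤ) (n : ℕ) :
    ∫ ω, (∑ i ∈ Finset.range n, centredHit μ Z B (s + i) ω) ^ 2 ∂μ ≤
      n / 4 + 2 * ∑ k ∈ Finset.Ico 1 n, ((n : ℝ) - k) * betaCoeff μ Z k := by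
  have hint : ∀ n : ℕ, Integrable
      (fun ω => (∑ i ∈ Finset.range n, centredHit μ Z B (s + i) ω) ^ 2) μ := by
    intro n
    simp_rw [sq, Finset.sum_mul_sum]
    exact integrable_finsetSum _ fun i _ => integrable_finsetSum _ fun j _ =>
      integrable_centredHit_mul hZ hB _ _
  induction n with
  | zero => simp
  | succ n ih =>
    have hexp : ∀ ω, (∑ i ∈ Finset.range (n + 1), centredHit μ Z B (s + i) ω) ^ 2 =
        (∑ i ∈ Finset.range n, centredHit μ Z B (s + i) ω) ^ 2
        + 2 * ∑ i ∈ Finset.range n, centredHit μ Z B (s + i) ω * centredHit μ Z B (s + n) ω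
        + centredHit μ Z B (s + n) ω * centredHit μ Z B (s + n) ω := by
      intro ω
      rw [Finset.sum_range_succ, ← Finset.sum_mul]; ring
    have hcross : Integrable (fun ω =>
        ∑ i ∈ Finset.range n, centredHit μ Z B (s + i) ω * centredHit μ Z B (s + n) ω) μ :=
      integrable_finsetSum _ fun i _ => integrable_centredHit_mul hZ hB _ _
    simp_rw [hexp]
    have hint2 : Integrable (fun ω => (∑ i ∈ Finset.range n, centredHit μ Z B (s + i) ω) ^ 2
        + 2 * ∑ i ∈ Finset.range n, centredHit μ Z B (s + i) ω * centredHit μ Z B (s + n) ω) μ :=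
      (hint n).add (hcross.const_mul 2)
    rw [integral_add hint2 (integrable_centredHit_mul hZ hB _ _),
      integral_add (hint n) (hcross.const_mul 2), integral_const_mul,
      integral_finsetSum _ fun i _ => integrable_centredHit_mul hZ hB _ _]
    have h1 : ∑ i ∈ Finset.range n,
        ∫ ω, centredHit μ Z B (s + i) ω * centredHit μ Z B (s + n) ω ∂μ ≤
        ∑ k ∈ Finset.Ico 1 (n + 1), betaCoeff μ Z k := by
      rw [Finset.sum_Ico_eq_sum_range, Nat.add_sub_cancel, 
        ← Finset.sum_range_reflect fun k => betaCoeff μ Z (1 + k)]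
      refine Finset.sum_le_sum fun i hi => ?_
      have hin : i < n := Finset.mem_range.1 hi
      have h := integral_centredHit_mul_le_betaCoeff hstat hZ hB (s + i) (n - i)
      rwa [show (s + i : ℤ) + ((n - i : ℕ) : ℤ) = s + n by omega,
        show n - i = 1 + (n - 1 - i) by omega] at h
    have h2 := integral_centredHit_sq_le hstat hZ hB (s + n)
    have h3 : ∑ k ∈ Finset.Ico 1 (n + 1), (((n + 1 : ℕ) : ℝ) - k) * betaCoeff μ Z k =
        ∑ k ∈ Finset.Ico 1 n, ((n : ℝ) - k) * betaCoeff μ Z k +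
          ∑ k ∈ Finset.Ico 1 (n + 1), betaCoeff μ Z k := by
      have : ∑ k ∈ Finset.Ico 1 n, ((n : ℝ) - k) * betaCoeff μ Z k =
          ∑ k ∈ Finset.Ico 1 (n + 1), ((n : ℝ) - k) * betaCoeff μ Z k := by
        rcases Nat.eq_zero_or_pos n with rfl | hn
        · simp
        · rw [Finset.sum_Ico_succ_top hn]; simp
      rw [this, ← Finset.sum_add_distrib]
      refine Finset.sum_congr rfl fun k _ => ?_
      push_cast; ring
    rw [h3]
    push_cast
    linarith

theorem sigmaTilde_sq {β : ℕ → ℝ} (hβ : ∀ k, 0 ≤ β k) (a : ℕ) :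
    sigmaTilde β a ^ 2 = 1 / 4 + 2 / (a : ℝ) * ∑ k ∈ Finset.Ico 1 a, ((a : ℝ) - k) * β k ∧
      0 < sigmaTilde β a := by
  have h : 0 ≤ 2 / (a : ℝ) * ∑ k ∈ Finset.Ico 1 a, ((a : ℝ) - k) * β k := by
    refine mul_nonneg (by positivity) (Finset.sum_nonneg fun k hk => mul_nonneg ?_ (hβ k))
    have : (k : ℝ) ≤ a := by exact_mod_cast (Finset.mem_Ico.1 hk).2.le
    linarith
  exact ⟨Real.sq_sqrt (by linarith), Real.sqrt_pos.2 (by linarith)⟩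

theorem integral_blockMean_sq_le [IsProbabilityMeasure μ] (hstat : IsStationary μ Z)
    (hZ : ∀ t, Measurable (Z t)) (hB : MeasurableSet B) {a : ℕ} (ha : 0 < a) (s : ℤ) :
    ∫ ω, blockMean μ Z B a s ω ^ 2 ∂μ ≤ sigmaTilde (betaCoeff μ Z) a ^ 2 / a := by
  have ha' : (0 : ℝ) < a := by exact_mod_cast ha
  simp_rw [blockMean, div_pow]
  rw [integral_div, (sigmaTilde_sq (betaCoeff_nonneg μ Z) a).1, div_le_div_iff₀ (by positivity) ha']
  have h := integral_sum_centredHit_sq_le hstat hZ hB s a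
  calc _ ≤ ((a : ℝ) / 4 + 2 * ∑ k ∈ Finset.Ico 1 a, ((a : ℝ) - k) * betaCoeff μ Z k) * a := by
        gcongr
    _ = _ := by field_simp

theorem integral_blockMean [IsProbabilityMeasure μ] (hstat : IsStationary μ Z)
    (hZ : ∀ t, Measurable (Z t)) (hB : MeasurableSet B) (a : ℕ) (s : ℤ) :
    ∫ ω, blockMean μ Z B a s ω ∂μ = 0 := by
  simp_rw [blockMean]
  rw [integral_div, integral_finsetSum _ fun i _ => Integrable.of_bound (C := 1)
    (measurable_centredHit hZ hB _).aestronglyMeasurable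
    (ae_of_all _ fun ω => abs_centredHit_le_one _ ω)]
  simp [integral_centredHit hstat hZ hB]

/-- The path functional behind `blockMean` is measurable. -/
theorem measurable_blockFunctional (hB : MeasurableSet B) (p : ℝ) (a : ℕ) (s : ℤ) :
    Measurable fun z : ℤ → E =>
      (∑ i ∈ Finset.range a, (B.indicator (fun _ => (1 : ℝ)) (z (s + i)) - p)) / a := by
  have h : ∀ t : ℤ, Measurable fun z : ℤ → E => B.indicator (fun _ => (1 : ℝ)) (z t) :=
    fun t => (measurable_const.indicator hB).comp (measurable_pi_apply t)
  exact (Finset.measurable_fun_sum _ fun i _ => (h _).sub_const _).div_const _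

theorem map_blockMean_eq (hstat : IsStationary μ Z) (hZ : ∀ t, Measurable (Z t))
    (hB : MeasurableSet B) (a : ℕ) (s s' : ℤ) :
    μ.map (blockMean μ Z B a s) = μ.map (blockMean μ Z B a s') := by
  set Φ : (ℤ → E) → ℝ := fun z => (∑ i ∈ Finset.range a,
    (B.indicator (fun _ => (1 : ℝ)) (z (0 + i)) - μ.real (Z 0 ⁻¹' B))) / a with hΦ
  have hΦm : Measurable Φ := measurable_blockFunctional hB _ a 0
  have h : ∀ s, blockMean μ Z B a s = fun ω => Φ fun t => Z (t + s) ω := by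
    intro s; funext ω
    simp only [blockMean, centredHit, hΦ, zero_add, add_comm s]
  rw [h, h, hstat.map_comp_shift hZ hΦm, hstat.map_comp_shift hZ hΦm]

/-- Bernstein's inequality for the means of every second block: consecutive ones are separated by
`a`, so that each of them costs `β(a)`. -/
theorem real_le_sum_blockMean_le [IsProbabilityMeasure μ] (hstat : IsStationary μ Z)
    (hZ : ∀ t, Measurable (Z t)) (hB : MeasurableSet B) {a : ℕ} (ha : 0 < a) (s : ℤ) (m : ℕ)
    {L : ℝ} (hL : 0 ≤ L) :
    μ.real {ω | Real.sqrt (2 * ((m + 1) * (sigmaTilde (betaCoeff μ Z) a ^ 2 / a)) * L) + L / 3 ≤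
        ∑ j ∈ Finset.range (m + 1), blockMean μ Z B a (s + 2 * a * j) ω} ≤
      Real.exp (-L) + m * betaCoeff μ Z a := by
  set v := sigmaTilde (betaCoeff μ Z) a ^ 2 / a with hv
  have ha' : (0 : ℝ) < a := by exact_mod_cast ha
  have hv0 : 0 < v := div_pos (pow_pos (sigmaTilde_sq (betaCoeff_nonneg μ Z) a).2 2) ha'
  obtain ⟨l, hl0, hl3, hl⟩ := exists_bernstein_exponent
    (V := (m + 1) * v) (L := L) (by positivity) hL
  set c := Real.sqrt (2 * ((m + 1) * v) * L) + L / 3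
  have hVm : ∀ s, Measurable (blockMean μ Z B a s) := measurable_blockMean hZ hB a
  set ν := μ.map (blockMean μ Z B a s) with hνdef
  have hν : IsProbabilityMeasure ν := Measure.isProbabilityMeasure_map (hVm s).aemeasurable
  have hmgf := integral_exp_mul_le (ν := ν) (v := v) (l := l)
    ((ae_map_iff (hVm s).aemeasurable (measurableSet_le (by fun_prop) measurable_const)).2
      (ae_of_all _ fun ω => abs_blockMean_le_one a s ω))
    (by
      rw [hνdef, integral_map (hVm s).aemeasurable (by fun_prop)]
      exact integral_blockMean hstat hZ hB a s)
    (by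
      rw [hνdef, integral_map (hVm s).aemeasurable (by fun_prop)]
      exact integral_blockMean_sq_le hstat hZ hB ha s) hl0 hl3
  have hdep : ∀ (m : ℕ) (c : ℝ), μ.real {ω | c ≤
      ∑ j ∈ Finset.range (m + 1), blockMean μ Z B a (s + 2 * a * j) ω
        + blockMean μ Z B a (s + 2 * a * ((m + 1 : ℕ) : ℤ)) ω} ≤
      ((μ.map fun ω => ∑ j ∈ Finset.range (m + 1),
        blockMean μ Z B a (s + 2 * a * j) ω).prod ν).real {p | c ≤ p.1 + p.2}
        + betaCoeff μ Z a := by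
    intro m c
    -- the block functional, applied to the path truncated on either side of the gap
    set Φ : ℤ → (ℤ → E) → ℝ := fun s z => (∑ i ∈ Finset.range a,
      (B.indicator (fun _ => (1 : ℝ)) (z (s + i)) - μ.real (Z 0 ⁻¹' B))) / a with hΦ
    have hΦm : ∀ s, Measurable (Φ s) := measurable_blockFunctional hB _ a
    have h := abs_real_pair_sub_prod_le_betaCoeff hZ hstat (s + 2 * a * m + a) a
      (Φ := fun z => ∑ j ∈ Finset.range (m + 1), Φ (s + 2 * a * j) z)
      (Finset.measurable_fun_sum _ fun j _ => hΦm _)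
      (Ψ := Φ (s + 2 * a * ((m + 1 : ℕ) : ℤ))) (hΦm _)
      (U := fun ω => ∑ j ∈ Finset.range (m + 1), blockMean μ Z B a (s + 2 * a * j) ω)
      (fun ω => by
        refine Finset.sum_congr rfl fun j hj => ?_
        simp only [hΦ, blockMean, centredHit]
        congr 1
        refine Finset.sum_congr rfl fun i hi => ?_
        have hj' : j ≤ m := Nat.lt_succ_iff.1 (Finset.mem_range.1 hj)
        have hi' := Finset.mem_range.1 hi
        rw [min_eq_left]
        have : (a : ℤ) * j ≤ a * m := by gcongr
        nlinarith)
      (V := blockMean μ Z B a (s + 2 * a * ((m + 1 : ℕ) : ℤ)))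
      (fun ω => by
        simp only [hΦ, blockMean, centredHit]
        congr 1
        refine Finset.sum_congr rfl fun i hi => ?_
        rw [max_eq_left]
        push_cast
        nlinarith)
      (A := {p : ℝ × ℝ | c ≤ p.1 + p.2}) (measurableSet_le measurable_const (by fun_prop))
    rw [map_blockMean_eq hstat hZ hB a _ s] at h
    exact sub_le_iff_le_add'.1 (abs_le.1 h).2
  have hmain := real_le_sum_le_of_almost_indep (μ := μ) (ν := ν)
    (V := fun j => blockMean μ Z B a (s + 2 * a * (j : ℤ))) (fun j => hVm _)
    (fun j => map_blockMean_eq hstat hZ hB a _ _) hdep hl0 hmgf.1 hmgf.2 m c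
  refine hmain.trans (le_of_eq ?_)
  rw [← Real.exp_nat_mul, ← Real.exp_add]
  congr 2
  rw [← hl]
  push_cast
  ring

/-- The deviation in Bernstein's inequality for a window of `2ma` consecutive indices. -/
theorem real_le_sum_centredHit_le [IsProbabilityMeasure μ] (hstat : IsStationary μ Z)
    (hZ : ∀ t, Measurable (Z t)) (hB : MeasurableSet B) {a : ℕ} (ha : 0 < a) (s : ℤ) {m : ℕ}
    (hm : 0 < m) {L : ℝ} (hL : 0 ≤ L) :
    μ.real {ω | 2 * a * (Real.sqrt (2 * (m * (sigmaTilde (betaCoeff μ Z) a ^ 2 / a)) * L) + L / 3) ≤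
        ∑ i ∈ Finset.range (2 * m * a), centredHit μ Z B (s + i) ω} ≤
      2 * (Real.exp (-L) + (m - 1) * betaCoeff μ Z a) := by
  obtain ⟨m, rfl⟩ : ∃ k, m = k + 1 := ⟨m - 1, by omega⟩
  have ha' : (0 : ℝ) < a := by exact_mod_cast ha
  have h1 := real_le_sum_blockMean_le hstat hZ hB ha s m hL
  have h2 := real_le_sum_blockMean_le hstat hZ hB ha (s + a) m hL
  push_cast
  rw [add_sub_cancel_right]
  set c := Real.sqrt (2 * ((m + 1) * (sigmaTilde (betaCoeff μ Z) a ^ 2 / a)) * L) + L / 3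
  refine (measureReal_mono (s₂ :=
    {ω | c ≤ ∑ j ∈ Finset.range (m + 1), blockMean μ Z B a (s + 2 * a * j) ω} ∪
    {ω | c ≤ ∑ j ∈ Finset.range (m + 1), blockMean μ Z B a (s + a + 2 * a * j) ω})
    fun ω hω => ?_).trans ((measureReal_union_le _ _).trans (by linarith))
  simp only [Set.mem_ofPred_eq, Set.mem_union] at hω ⊢
  rw [sum_centredHit_eq_sum_blockMean ha] at hω
  by_contra! hcon
  nlinarith [hcon.1, hcon.2]

end Blocks

/-! ### Windows after a training sample -/

theorem prod_real_le_of_forall_section {S T : Type*} [MeasurableSpace S] [MeasurableSpace T]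
    (ρ : Measure S) (ν : Measure T) [IsProbabilityMeasure ρ] [IsProbabilityMeasure ν]
    {A : Set (S × T)} (hA : MeasurableSet A) {C : ℝ}
    (h : ∀ w, ν.real (Prod.mk w ⁻¹' A) ≤ C) : (ρ.prod ν).real A ≤ C := by
  have hfub : (ρ.prod ν).real A = ∫ w, ν.real (Prod.mk w ⁻¹' A) ∂ρ := by
    rw [measureReal_def, Measure.prod_apply hA, ← integral_toReal]
    · rfl
    · exact (measurable_measure_prodMk_left hA).aemeasurable
    · exact ae_of_all _ fun _ => measure_lt_top _ _
  rw [hfub]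
  refine (integral_mono_of_nonneg (ae_of_all _ fun _ => measureReal_nonneg)
    (integrable_const C) (ae_of_all _ h)).trans (by simp)

theorem bernstein_deviation_eq {σ L : ℝ} (hσ : 0 ≤ σ) {a : ℕ} (ha : 0 < a) (m : ℕ) :
    2 * a * (Real.sqrt (2 * (m * (σ ^ 2 / a)) * L) + L / 3) =
      σ * Real.sqrt (4 * (2 * m * a) * L) + 2 * a / 3 * L := by
  have ha' : (0 : ℝ) < a := by exact_mod_cast ha
  have h : 2 * a * Real.sqrt (2 * (m * (σ ^ 2 / a)) * L) =
      σ * Real.sqrt (4 * (2 * m * a) * L) := by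
    rw [← Real.sqrt_sq (show (0 : ℝ) ≤ 2 * a by positivity), ← Real.sqrt_mul (sq_nonneg _),
      ← Real.sqrt_sq hσ, ← Real.sqrt_mul (sq_nonneg _), Real.sqrt_sq hσ]
    congr 1
    field_simp
    ring
  linear_combination h

/-- Deviation bound on a window of `2ma` indices for a random set `A_U`, where `U` is a functional
of the process up to time `τ`: conditioning on `U` as if it were independent of the window costs
`β(g)`, with `g` the gap between `τ` and the window. -/
theorem real_le_sum_indicator_sub_le {Ω E : Type*} [MeasurableSpace Ω] [MeasurableSpace E]
    {μ : Measure Ω} {Z : ℤ → Ω → E} [IsProbabilityMeasure μ] (hstat : IsStationary μ Z)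
    (hZ : ∀ t, Measurable (Z t)) (τ : ℤ) {T : Type*} [MeasurableSpace T]
    {Φ : (ℤ → E) → T} (hΦ : Measurable Φ) {U : Ω → T}
    (hU : ∀ ω, U ω = Φ fun t => Z (min t τ) ω) {A : Set (T × E)} (hA : MeasurableSet A)
    (g : ℕ) {s : ℤ} (hs : τ + g ≤ s) {a : ℕ} (ha : 0 < a) {m : ℕ} (hm : 0 < m)
    {L : ℝ} (hL : 0 ≤ L) :
    MeasurableSet {ω | sigmaTilde (betaCoeff μ Z) a * Real.sqrt (4 * (2 * m * a) * L)
        + 2 * a / 3 * L ≤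
      ∑ i ∈ Finset.range (2 * m * a), (A.indicator (fun _ => (1 : ℝ)) (U ω, Z (s + i) ω)
        - (μ.map (Z 0)).real (Prod.mk (U ω) ⁻¹' A))} ∧
    μ.real {ω | sigmaTilde (betaCoeff μ Z) a * Real.sqrt (4 * (2 * m * a) * L)
        + 2 * a / 3 * L ≤
      ∑ i ∈ Finset.range (2 * m * a), (A.indicator (fun _ => (1 : ℝ)) (U ω, Z (s + i) ω)
        - (μ.map (Z 0)).real (Prod.mk (U ω) ⁻¹' A))} ≤
      2 * (Real.exp (-L) + (m - 1) * betaCoeff μ Z a) + betaCoeff μ Z g := by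
  rw [← bernstein_deviation_eq (sigmaTilde_sq (betaCoeff_nonneg μ Z) a).2.le ha m]
  set c := 2 * a *
    (Real.sqrt (2 * (m * (sigmaTilde (betaCoeff μ Z) a ^ 2 / a)) * L) + L / 3) with hc
  have : IsProbabilityMeasure (μ.map (Z 0)) :=
    Measure.isProbabilityMeasure_map (hZ 0).aemeasurable
  have hUm : Measurable U := by
    have : U = fun ω => Φ fun t => Z (min t τ) ω := funext hU
    rw [this]
    exact hΦ.comp (measurable_pi_lambda (fun ω (t : ℤ) => Z (min t τ) ω) fun t => hZ _)
  set V : Ω → ℕ → E := fun ω i => Z (s + i) ω with hV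
  have hVm : Measurable V := measurable_pi_lambda _ fun i => hZ _
  set D : Set (T × (ℕ → E)) := {q | c ≤ ∑ i ∈ Finset.range (2 * m * a),
    (A.indicator (fun _ => (1 : ℝ)) (q.1, q.2 i)
      - (μ.map (Z 0)).real (Prod.mk q.1 ⁻¹' A))} with hD
  have hDm : MeasurableSet D := by
    refine measurableSet_le measurable_const (Finset.measurable_fun_sum _ fun i _ => ?_)
    refine Measurable.sub ?_ ?_
    · exact (measurable_const.indicator hA).comp
        (measurable_fst.prodMk ((measurable_pi_apply i).comp measurable_snd))
    · exact (measurable_measure_prodMk_left hA).ennreal_toReal.comp measurable_fst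
  refine ⟨(hUm.prodMk hVm) hDm, ?_⟩
  have := Measure.isProbabilityMeasure_map (μ := μ) hUm.aemeasurable
  have := Measure.isProbabilityMeasure_map (μ := μ) hVm.aemeasurable
  have hdec := abs_real_pair_sub_prod_le_betaCoeff hZ hstat τ g hΦ
    (Ψ := fun z (i : ℕ) => z (s + i)) (measurable_pi_lambda _ fun i => measurable_pi_apply _)
    hU (V := V) (fun ω => by
      funext i
      simp only [hV]
      rw [max_eq_left (by omega)]) hDm
  have hprod : ((μ.map U).prod (μ.map V)).real D ≤
      2 * (Real.exp (-L) + (m - 1) * betaCoeff μ Z a) := by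
    refine prod_real_le_of_forall_section _ _ hDm fun w => ?_
    have hAw : MeasurableSet (Prod.mk w ⁻¹' A) := measurable_prodMk_left hA
    rw [map_measureReal_apply hVm (measurable_prodMk_left hDm)]
    refine le_trans (le_of_eq ?_) (real_le_sum_centredHit_le hstat hZ hAw ha s hm hL)
    congr 1
    ext ω
    simp only [hD, hV, Set.mem_preimage, Set.mem_ofPred_eq, centredHit,
      map_measureReal_apply (hZ 0) hAw, ← hc]
    rfl
  have := sub_le_iff_le_add'.1 (abs_le.1 hdec).2
  exact this.trans (by linarith)

/-! ### Population quantiles -/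

/-- The quantile of level `p` of a law on the line. -/
noncomputable def lawQuantile (ν : Measure ℝ) (p : ℝ) : ℝ := sInf {t | p ≤ ν.real (Set.Iic t)}

section Quantile

variable {ν : Measure ℝ} [IsProbabilityMeasure ν] {p : ℝ}

theorem le_real_Iic_iff_lawQuantile_le (hp0 : 0 < p) (hp1 : p < 1) (t : ℝ) :
    p ≤ ν.real (Set.Iic t) ↔ lawQuantile ν p ≤ t := by
  set F := ProbabilityTheory.cdf ν
  have hF : ∀ t, ν.real (Set.Iic t) = F t := fun t => (ProbabilityTheory.cdf_eq_real ν t).symm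
  have hbdd : BddBelow {t | p ≤ ν.real (Set.Iic t)} := by
    obtain ⟨b, hb⟩ := ((ProbabilityTheory.tendsto_cdf_atBot ν).eventually_lt_const hp0).exists
    refine ⟨b, fun t ht => ?_⟩
    simp only [Set.mem_ofPred_eq, hF] at ht
    by_contra! hlt
    exact absurd (F.mono hlt.le) (by linarith)
  have hne : {t | p ≤ ν.real (Set.Iic t)}.Nonempty := by
    obtain ⟨b, hb⟩ := ((ProbabilityTheory.tendsto_cdf_atTop ν).eventually_const_lt hp1).exists
    exact ⟨b, by simp only [Set.mem_ofPred_eq, hF]; exact hb.le⟩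
  refine ⟨fun h => csInf_le hbdd h, fun h => ?_⟩
  rw [hF]
  refine le_trans ?_ (F.mono h)
  by_contra! hlt
  -- by right-continuity the distribution function stays below `p` beyond the quantile
  have hev : ∀ᶠ x in 𝓝[>] (lawQuantile ν p), F x < p :=
    ((F.right_continuous _).mono Set.Ioi_subset_Ici_self).eventually_lt_const hlt
  obtain ⟨x, hx, hxq⟩ := (hev.and self_mem_nhdsWithin).exists
  obtain ⟨y, hy, hyx⟩ := exists_lt_of_csInf_lt hne hxq
  simp only [Set.mem_ofPred_eq, hF] at hy
  exact absurd (F.mono hyx.le) (by linarith)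

theorem real_Iio_lawQuantile_le (hp0 : 0 < p) (hp1 : p < 1) :
    ν.real (Set.Iio (lawQuantile ν p)) ≤ p := by
  have hlim : Function.leftLim (ProbabilityTheory.cdf ν) (lawQuantile ν p) ≤ p := by
    refine le_of_tendsto ((ProbabilityTheory.cdf ν).mono.tendsto_leftLim _) ?_
    filter_upwards [self_mem_nhdsWithin] with x hx
    rw [ProbabilityTheory.cdf_eq_real]
    by_contra! h
    exact absurd ((le_real_Iic_iff_lawQuantile_le hp0 hp1 x).1 h.le) (not_le.2 hx)
  have h := (ProbabilityTheory.cdf ν).measure_Iio (ProbabilityTheory.tendsto_cdf_atBot ν)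
    (lawQuantile ν p)
  rw [ProbabilityTheory.measure_cdf, sub_zero] at h
  rw [measureReal_def, h]
  exact ENNReal.toReal_le_of_le_ofReal hp0.le (ENNReal.ofReal_le_ofReal hlim)

end Quantile

/-- The quantile of the score of an independent observation, as a function of the training sample,
is measurable. -/
theorem measurable_lawQuantile_map {T E : Type*} [MeasurableSpace T] [MeasurableSpace E]
    (ρ : Measure E) [IsProbabilityMeasure ρ] {f : T → E → ℝ} (hf : Measurable (Function.uncurry f))
    {p : ℝ} (hp0 : 0 < p) (hp1 : p < 1) :
    Measurable fun w => lawQuantile (ρ.map (f w)) p := by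
  have hfw : ∀ w, Measurable (f w) := fun w => hf.comp measurable_prodMk_left
  refine measurable_of_Iic fun t => ?_
  have h : (fun w => lawQuantile (ρ.map (f w)) p) ⁻¹' Set.Iic t =
      {w | p ≤ ρ.real (Prod.mk w ⁻¹' {x | Function.uncurry f x ≤ t})} := by
    ext w
    have := Measure.isProbabilityMeasure_map (μ := ρ) (hfw w).aemeasurable
    rw [Set.mem_preimage, Set.mem_Iic, ← le_real_Iic_iff_lawQuantile_le hp0 hp1,
      map_measureReal_apply (hfw w) measurableSet_Iic]
    rfl
  rw [h]
  exact measurableSet_le measurable_const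
    (measurable_measure_prodMk_left (measurableSet_le hf measurable_const)).ennreal_toReal

/-! ### Slack terms -/

theorem exists_calBound_eq {β : ℕ → ℝ} {ncal : ℕ} {δ : ℝ} (h : (calFeasible β ncal δ).Nonempty) :
    ∃ a m r, (a, m, r) ∈ calFeasible β ncal δ ∧ epsCal β ncal δ = calBound β ncal δ a m r := by
  have hfin : (calFeasible β ncal δ).Finite := by
    refine (Set.finite_Iic ((ncal + 1, ncal + 1, ncal + 1) : ℕ × ℕ × ℕ)).subset ?_
    rintro ⟨a, m, r⟩ ⟨ha, hm, hr, hsum, -⟩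
    simp only at ha hm hr hsum
    refine ⟨?_, ?_, ?_⟩ <;> simp only <;> nlinarith
  obtain ⟨⟨a, m, r⟩, hp, he⟩ := (h.image _).csInf_mem (hfin.image
    fun p : ℕ × ℕ × ℕ => calBound β ncal δ p.1 p.2.1 p.2.2)
  exact ⟨a, m, r, hp, he.symm⟩

theorem exists_testBound_eq {β : ℕ → ℝ} {ncal ntest : ℕ} {δ : ℝ}
    (h : (testFeasible β ncal ntest δ).Nonempty) :
    ∃ a m u, (a, m, u) ∈ testFeasible β ncal ntest δ ∧
      epsTest β ncal ntest δ = testBound β ncal ntest δ a m u := by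
  have hfin : (testFeasible β ncal ntest δ).Finite := by
    refine (Set.finite_Iic ((ntest, ntest, ntest) : ℕ × ℕ × ℕ)).subset ?_
    rintro ⟨a, m, u⟩ ⟨ha, hm, hsum, -⟩
    simp only at ha hm hsum
    refine ⟨?_, ?_, ?_⟩ <;> simp only <;> nlinarith
  obtain ⟨⟨a, m, u⟩, hp, he⟩ := (h.image _).csInf_mem (hfin.image
    fun p : ℕ × ℕ × ℕ => testBound β ncal ntest δ p.1 p.2.1 p.2.2)
  exact ⟨a, m, u, hp, he.symm⟩

/-- With `L = log (4 / (δ - 4(m-1)β(a) - β(g)))` the failure probability stays below `δ`. Only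
one-sided deviations occur, so the constants `4` leave a factor `2` to spare. -/
theorem failure_prob_le {δ b c : ℝ} {m : ℕ} (hm : 0 < m) (hb : 0 ≤ b) (hc : 0 ≤ c) (hδ : δ < 1)
    (h : 4 * ((m : ℝ) - 1) * b + c < δ) :
    0 ≤ Real.log (4 / (δ - 4 * ((m : ℝ) - 1) * b - c)) ∧
      2 * (Real.exp (-Real.log (4 / (δ - 4 * ((m : ℝ) - 1) * b - c))) + (m - 1) * b) + c ≤ δ := by
  have hm' : (1 : ℝ) ≤ m := by exact_mod_cast hm
  have hmb : 0 ≤ ((m : ℝ) - 1) * b := mul_nonneg (by linarith) hb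
  set d := δ - 4 * ((m : ℝ) - 1) * b - c with hd
  have hd0 : 0 < d := by linarith
  refine ⟨Real.log_nonneg ?_, ?_⟩
  · rw [le_div_iff₀ hd0]; linarith
  · rw [← Real.log_inv, inv_div, Real.exp_log (by positivity)]
    linarith

/-- The deviation over `2ma ≤ n` indices is at most `n` times the deviation normalised by `n`. -/
theorem deviation_le_mul {σ L n : ℝ} {m a : ℕ} (hσ : 0 ≤ σ) (hL : 0 ≤ L) (hm : 0 < m)
    (hn : 0 < n) (hNn : 2 * m * a ≤ n) :
    σ * Real.sqrt (4 * (2 * m * a) * L) + 2 * a / 3 * L ≤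
      n * (σ * Real.sqrt (4 / n * L) + 1 / (3 * m) * L) := by
  have hm' : (0 : ℝ) < m := by exact_mod_cast hm
  have h1 : Real.sqrt (4 * (2 * m * a) * L) ≤ n * Real.sqrt (4 / n * L) := by
    refine Real.sqrt_le_iff.2 ⟨by positivity, ?_⟩
    rw [mul_pow, Real.sq_sqrt (by positivity)]
    calc 4 * (2 * m * a) * L ≤ 4 * n * L := by gcongr
      _ = n ^ 2 * (4 / n * L) := by field_simp
  have h2 : 2 * a / 3 * L ≤ n * (1 / (3 * m) * L) := by
    calc 2 * a / 3 * L = 2 * m * a * (1 / (3 * m) * L) := by field_simp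
      _ ≤ _ := by gcongr
  calc _ ≤ σ * (n * Real.sqrt (4 / n * L)) + n * (1 / (3 * m) * L) := by gcongr
    _ = _ := by ring

/-! ### Counting on the sample -/

theorem sum_Icc_succ_eq_sum_range (f : ℕ → ℝ) (c n : ℕ) :
    ∑ i ∈ Finset.Icc (c + 1) (c + n), f i = ∑ j ∈ Finset.range n, f (c + 1 + j) := by
  rw [← Finset.Ico_succ_right_eq_Icc, Finset.sum_Ico_eq_sum_range]
  congr 2
  simp only [Order.succ_eq_add_one]; omega

section Counting

variable {Ω 𝒳 𝒴 : Type*} {X : ℤ → Ω → 𝒳} {Y : ℤ → Ω → 𝒴} {ntrain ncal ntest : ℕ}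
  {s : (Fin ntrain → 𝒳 × 𝒴) → 𝒳 × 𝒴 → ℝ} {α : ℝ} {ω : Ω}

open Classical in
/-- If the empirical quantile lies below `q`, a proportion `1 - α` of the calibration scores does.
-/
theorem le_card_of_calQuantile_lt (hn : 0 < ncal) (hα : 0 ≤ α) {q : ℝ}
    (hq : calQuantile X Y ntrain ncal s α ω < q) :
    (1 - α) * ncal ≤ ∑ i ∈ calIdx ntrain ncal,
      if trainedScore X Y ntrain s ω (X i ω) (Y i ω) < q then (1 : ℝ) else 0 := by
  have hn' : (0 : ℝ) < ncal := by exact_mod_cast hn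
  -- non-emptiness matters here: the infimum over an empty set would be the junk value `0`
  have hne : {t : ℝ | 1 - α ≤ 1 / (ncal : ℝ) * ∑ i ∈ calIdx ntrain ncal,
      if trainedScore X Y ntrain s ω (X i ω) (Y i ω) ≤ t then (1 : ℝ) else 0}.Nonempty := by
    obtain ⟨M, hM⟩ := ((calIdx ntrain ncal).image
      fun i : ℕ => trainedScore X Y ntrain s ω (X i ω) (Y i ω)).bddAbove
    refine ⟨M, ?_⟩
    rw [Set.mem_ofPred_eq, Finset.sum_congr rfl fun i hi =>
      if_pos (hM (Finset.mem_coe.2 (Finset.mem_image_of_mem _ hi)))]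
    simp only [Finset.sum_const, calIdx, Nat.card_Icc, nsmul_eq_mul, mul_one]
    rw [show ntrain + ncal + 1 - (ntrain + 1) = ncal by omega, one_div_mul_cancel hn'.ne']
    linarith
  obtain ⟨t, ht, htq⟩ := exists_lt_of_csInf_lt hne hq
  rw [Set.mem_ofPred_eq, one_div_mul_eq_div, le_div_iff₀ hn'] at ht
  refine ht.trans (Finset.sum_le_sum fun i _ => ?_)
  split_ifs <;> linarith

open Classical in
/-- If `q` is at most the empirical quantile, only test points with score above `q` are missed. -/
theorem sub_card_le_testCoverage {q : ℝ} (hn : 0 < ntest)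
    (hq : q ≤ calQuantile X Y ntrain ncal s α ω) :
    ntest - (∑ i ∈ testIdx ntrain ncal ntest,
      if q < trainedScore X Y ntrain s ω (X i ω) (Y i ω) then (1 : ℝ) else 0) ≤
      ntest * testCoverage X Y ntrain ncal ntest s α ω := by
  have hn' : (0 : ℝ) < ntest := by exact_mod_cast hn
  rw [testCoverage, ← mul_assoc, mul_one_div_cancel hn'.ne', one_mul, sub_le_iff_le_add,
    ← Finset.sum_add_distrib]
  have hcard : (ntest : ℝ) = ∑ i ∈ testIdx ntrain ncal ntest, (1 : ℝ) := by
    simp only [Finset.sum_const, testIdx, Nat.card_Icc, nsmul_eq_mul, mul_one]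
    congr 1; omega
  rw [hcard]
  refine Finset.sum_le_sum fun i _ => ?_
  by_cases h : Y i ω ∈ predictionSet X Y ntrain ncal s α ω (X i ω)
  · rw [if_pos h, le_add_iff_nonneg_right]
    split_ifs <;> norm_num
  · rw [if_neg h, if_pos (hq.trans_lt (not_le.1 h)), zero_add]

end Counting

end SplitCP

/-! ### Coverage of the test sample -/

open SplitCP in
theorem mainTheorem4 {Ω 𝒳 𝒴 : Type*} [MeasurableSpace Ω] [MeasurableSpace 𝒳]
    [MeasurableSpace 𝒴] (μ : Measure Ω) [IsProbabilityMeasure μ]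
    (X : ℤ → Ω → 𝒳) (Y : ℤ → Ω → 𝒴)
    (hX : ∀ t, Measurable (X t)) (hY : ∀ t, Measurable (Y t))
    (hstat : SplitCP.IsStationary μ (fun t ω => (X t ω, Y t ω)))
    (hmix : SplitCP.IsBetaMixing μ (fun t ω => (X t ω, Y t ω)))
    (ntrain ncal ntest : ℕ)
    (s : (Fin ntrain → 𝒳 × 𝒴) → 𝒳 × 𝒴 → ℝ)
    (hs : Measurable (Function.uncurry s))
    (α : ℝ) (hα : α ∈ Set.Ioo (0 : ℝ) 1)
    (δcal δtest : ℝ) (hδcal : δcal ∈ Set.Ioo (0 : ℝ) 1) (hδtest : δtest ∈ Set.Ioo (0 : ℝ) 1)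
    (β : ℕ → ℝ) (hβ : β = SplitCP.betaCoeff μ (fun t ω => (X t ω, Y t ω)))
    (hFcal : (SplitCP.calFeasible β ncal δcal).Nonempty)
    (hFtest : (SplitCP.testFeasible β ncal ntest δtest).Nonempty) :
    1 - δcal - δtest ≤
      μ.real {ω | 1 - α - (SplitCP.epsCal β ncal δcal + SplitCP.epsTest β ncal ntest δtest) ≤
        SplitCP.testCoverage X Y ntrain ncal ntest s α ω} := by
  set Z : ℤ → Ω → 𝒳 × 𝒴 := fun t ω => (X t ω, Y t ω) with hZdef
  have hZ : ∀ t, Measurable (Z t) := fun t => (hX t).prodMk (hY t)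
  have hβ0 : ∀ k, 0 ≤ β k := fun k => hβ ▸ betaCoeff_nonneg μ Z k
  obtain ⟨a, m, r, ⟨ha, hm, hr, hsum, hfeas⟩, hcal⟩ := exists_calBound_eq hFcal
  obtain ⟨a', m', u, ⟨ha', hm', hsum', hfeas'⟩, htest⟩ := exists_testBound_eq hFtest
  simp only at ha hm hr hsum hfeas ha' hm' hsum' hfeas'
  obtain ⟨hL, hprob⟩ := failure_prob_le hm (hβ0 a) (hβ0 r) hδcal.2 hfeas
  obtain ⟨hL', hprob'⟩ := failure_prob_le hm' (hβ0 a') (hβ0 ncal) hδtest.2 hfeas'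
  simp only [calBound] at hcal
  simp only [testBound] at htest
  set L := Real.log (4 / (δcal - 4 * ((m : ℝ) - 1) * β a - β r))
  set L' := Real.log (4 / (δtest - 4 * ((m' : ℝ) - 1) * β a' - β ncal))
  set εcal := epsCal β ncal δcal
  set εtest := epsTest β ncal ntest δtest
  have hma : 0 < m * a := Nat.mul_pos hm ha
  have hma' : 0 < m' * a' := Nat.mul_pos hm' ha'
  have hncal : 0 < ncal := by nlinarith
  have hntest : 0 < ntest := by nlinarith
  have hncalR : (0 : ℝ) < ncal := by exact_mod_cast hncal
  have hntestR : (0 : ℝ) < ntest := by exact_mod_cast hntest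
  have hrR : (1 : ℝ) ≤ r := by exact_mod_cast hr
  have hσ := sigmaTilde_sq hβ0 a
  have hσ' := sigmaTilde_sq hβ0 a'
  have hNR : (ncal : ℝ) - r + 1 = 2 * m * a := by
    have : (2 * m * a + r : ℝ) = ncal + 1 := by exact_mod_cast hsum
    linarith
  have hNR' : (ntest : ℝ) - u = 2 * m' * a' := by
    have : (u + 2 * m' * a' : ℝ) = ntest := by exact_mod_cast hsum'
    linarith
  have hN0 : (0 : ℝ) < 2 * m * a := by exact_mod_cast (by nlinarith : 0 < 2 * m * a)
  have hN0' : (0 : ℝ) < 2 * m' * a' := by exact_mod_cast (by nlinarith : 0 < 2 * m' * a')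
  have hcalpos : 0 ≤ εcal := by
    rw [hcal]
    have : 0 ≤ ((r : ℝ) - 1) / ncal := div_nonneg (by linarith) hncalR.le
    have := mul_nonneg hσ.2.le (Real.sqrt_nonneg (4 / ((ncal : ℝ) - r + 1) * L))
    have : 0 ≤ 1 / (3 * (m : ℝ)) * L := by positivity
    linarith
  have htestpos : 0 ≤ εtest := by
    rw [htest]
    have := mul_nonneg hσ'.2.le (Real.sqrt_nonneg (4 / (ntest : ℝ) * L'))
    have : 0 ≤ 1 / (3 * (m' : ℝ)) * L' := by positivity
    positivity
  set p := 1 - α - εcal with hp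
  have hp1 : p < 1 := by linarith [hα.1]
  -- for `p ≤ 0` there is no population quantile, but then the coverage claim is void
  rcases le_or_gt p 0 with hp0 | hp0
  · have huniv : {ω | 1 - α - (εcal + εtest) ≤ testCoverage X Y ntrain ncal ntest s α ω} =
        Set.univ := by
      refine Set.eq_univ_of_forall fun ω => ?_
      have : 0 ≤ testCoverage X Y ntrain ncal ntest s α ω := by
        refine mul_nonneg (by positivity) (Finset.sum_nonneg fun i _ => ?_)
        split_ifs <;> norm_num
      rw [Set.mem_ofPred_eq]
      linarith
    rw [huniv, probReal_univ]
    linarith [hδcal.1, hδtest.1]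
  have hρ : IsProbabilityMeasure (μ.map (Z 0)) :=
    Measure.isProbabilityMeasure_map (hZ 0).aemeasurable
  set ρ := μ.map (Z 0) with hρdef
  set q : (Fin ntrain → 𝒳 × 𝒴) → ℝ := fun w => lawQuantile (ρ.map (s w)) p with hq
  have hqm : Measurable q := measurable_lawQuantile_map ρ hs hp0 hp1
  have hsw : ∀ w, Measurable (s w) := fun w => hs.comp measurable_prodMk_left
  set U : Ω → Fin ntrain → 𝒳 × 𝒴 := trainSample X Y ntrain with hU
  set A : Set ((Fin ntrain → 𝒳 × 𝒴) × (𝒳 × 𝒴)) := {x | Function.uncurry s x < q x.1} with hA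
  set A' : Set ((Fin ntrain → 𝒳 × 𝒴) × (𝒳 × 𝒴)) := {x | q x.1 < Function.uncurry s x} with hA'
  have hAm : MeasurableSet A := measurableSet_lt hs (hqm.comp measurable_fst)
  have hAm' : MeasurableSet A' := measurableSet_lt (hqm.comp measurable_fst) hs
  have hAq : ∀ w, ρ.real (Prod.mk w ⁻¹' A) ≤ p := fun w => by
    have := Measure.isProbabilityMeasure_map (μ := ρ) (hsw w).aemeasurable
    have h := real_Iio_lawQuantile_le (ν := ρ.map (s w)) hp0 hp1
    rwa [map_measureReal_apply (hsw w) measurableSet_Iio] at h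
  have hAq' : ∀ w, ρ.real (Prod.mk w ⁻¹' A') ≤ 1 - p := fun w => by
    have := Measure.isProbabilityMeasure_map (μ := ρ) (hsw w).aemeasurable
    have h := (le_real_Iic_iff_lawQuantile_le (ν := ρ.map (s w)) hp0 hp1 _).2 le_rfl
    have hc : (ρ.map (s w)).real (Set.Ioi (q w)) = 1 - (ρ.map (s w)).real (Set.Iic (q w)) := by
      rw [← Set.compl_Iic, probReal_compl_eq_one_sub measurableSet_Iic]
    rw [map_measureReal_apply (hsw w) measurableSet_Ioi] at hc
    exact hc.le.trans (by linarith)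
  -- the training sample as a functional of the path up to time `ntrain`
  have hΦ : Measurable fun (z : ℤ → 𝒳 × 𝒴) (j : Fin ntrain) => z ((j : ℕ) + 1 : ℤ) :=
    measurable_pi_lambda _ fun j => measurable_pi_apply _
  have hUΦ : ∀ ω, U ω = (fun (z : ℤ → 𝒳 × 𝒴) (j : Fin ntrain) => z ((j : ℕ) + 1 : ℤ))
      fun t => Z (min t ntrain) ω := by
    intro ω
    funext j
    have := j.2
    simp only [hU, trainSample, hZdef]
    rw [min_eq_left (by omega)]
  obtain ⟨hB, hBμ⟩ := real_le_sum_indicator_sub_le hstat hZ ntrain hΦ hUΦ hAm r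
    (s := (ntrain + r : ℕ)) (by push_cast; rfl) ha hm hL
  obtain ⟨hB', hBμ'⟩ := real_le_sum_indicator_sub_le hstat hZ ntrain hΦ hUΦ hAm' ncal
    (s := (ntrain + ncal + 1 : ℕ)) (by push_cast; omega) ha' hm' hL'
  rw [← hβ, ← hρdef] at hB hBμ hB' hBμ'
  replace hBμ := hBμ.trans hprob
  replace hBμ' := hBμ'.trans hprob'
  set bad := {ω | sigmaTilde β a * Real.sqrt (4 * (2 * m * a) * L) + 2 * a / 3 * L ≤
    ∑ i ∈ Finset.range (2 * m * a), (A.indicator (fun _ => (1 : ℝ))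
      (U ω, Z ((ntrain + r : ℕ) + i) ω) - ρ.real (Prod.mk (U ω) ⁻¹' A))} with hbad
  set bad' := {ω | sigmaTilde β a' * Real.sqrt (4 * (2 * m' * a') * L') + 2 * a' / 3 * L' ≤
    ∑ i ∈ Finset.range (2 * m' * a'), (A'.indicator (fun _ => (1 : ℝ))
      (U ω, Z ((ntrain + ncal + 1 : ℕ) + i) ω) - ρ.real (Prod.mk (U ω) ⁻¹' A'))} with hbad'
  have hgood : (bad ∪ bad')ᶜ ⊆
      {ω | 1 - α - (εcal + εtest) ≤ testCoverage X Y ntrain ncal ntest s α ω} := by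
    intro ω hω
    simp only [Set.mem_compl_iff, Set.mem_union, not_or] at hω
    obtain ⟨hω1, hω2⟩ := hω
    have hqq : q (U ω) ≤ calQuantile X Y ntrain ncal s α ω := by
      by_contra! hlt
      refine hω1 ?_
      have hcount := le_card_of_calQuantile_lt hncal hα.1.le hlt
      rw [calIdx, sum_Icc_succ_eq_sum_range] at hcount
      nth_rw 2 [show ncal = (r - 1) + 2 * m * a by omega] at hcount
      rw [Finset.sum_range_add] at hcount
      have hdrop : ∑ j ∈ Finset.range (r - 1),
          (if trainedScore X Y ntrain s ω (X (ntrain + 1 + j : ℕ) ω) (Y (ntrain + 1 + j : ℕ) ω)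
            < q (U ω) then (1 : ℝ) else 0) ≤ r - 1 := by
        refine (Finset.sum_le_sum (g := fun _ => (1 : ℝ)) fun j _ => ?_).trans_eq ?_
        · split_ifs <;> norm_num
        · simp [Nat.cast_sub hr]
      have hwin : ∀ j : ℕ, (if trainedScore X Y ntrain s ω (X (ntrain + 1 + (r - 1 + j) : ℕ) ω)
          (Y (ntrain + 1 + (r - 1 + j) : ℕ) ω) < q (U ω) then (1 : ℝ) else 0) =
          A.indicator (fun _ => (1 : ℝ)) (U ω, Z ((ntrain + r : ℕ) + j) ω) := by
        intro j
        rw [Set.indicator_apply, show ((ntrain + r : ℕ) + j : ℤ) =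
          (ntrain + 1 + (r - 1 + j) : ℕ) by omega]
        rfl
      simp_rw [hwin] at hcount
      rw [hbad, Set.mem_ofPred_eq, Finset.sum_sub_distrib, Finset.sum_const, Finset.card_range,
        nsmul_eq_mul, show ((2 * m * a : ℕ) : ℝ) = 2 * m * a by push_cast; rfl]
      set C := ∑ i ∈ Finset.range (2 * m * a),
        A.indicator (fun _ => (1 : ℝ)) (U ω, Z ((ntrain + r : ℕ) + i) ω)
      have hC : 0 ≤ C := Finset.sum_nonneg fun i _ =>
        Set.indicator_nonneg (fun _ _ => zero_le_one) _
      have hdev := deviation_le_mul hσ.2.le hL hm hN0 le_rfl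
      have hmean := mul_le_mul_of_nonneg_left (hAq (U ω)) hN0.le
      rw [hNR] at hcal
      -- a window frequency is at least the share of its hits in the whole calibration sample
      have hx : 2 * m * a * (1 - α - ((r : ℝ) - 1) / ncal) ≤ C := by
        have hle : (1 - α - ((r : ℝ) - 1) / ncal) * ncal ≤ C := by
          rw [sub_mul, div_mul_cancel₀ _ hncalR.ne']; linarith
        rcases le_total 0 (1 - α - ((r : ℝ) - 1) / ncal) with h0 | h0
        · rw [mul_comm]
          exact (mul_le_mul_of_nonneg_left (by linarith) h0).trans hle
        · exact (mul_nonpos_of_nonneg_of_nonpos hN0.le h0).trans hC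
      have hε : sigmaTilde β a * Real.sqrt (4 / (2 * m * a) * L) + 1 / (3 * m) * L =
          (1 - α - ((r : ℝ) - 1) / ncal) - p := by rw [hp, hcal]; ring
      rw [hε, mul_sub] at hdev
      linarith
    have hcount := sub_card_le_testCoverage hntest hqq
    rw [testIdx, sum_Icc_succ_eq_sum_range] at hcount
    nth_rw 2 [← hsum'] at hcount
    rw [add_comm u, Finset.sum_range_add] at hcount
    have hdrop : ∑ j ∈ Finset.range u,
        (if q (U ω) < trainedScore X Y ntrain s ω
          (X (ntrain + ncal + 1 + (2 * m' * a' + j) : ℕ) ω)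
          (Y (ntrain + ncal + 1 + (2 * m' * a' + j) : ℕ) ω) then (1 : ℝ) else 0) ≤ u := by
      refine (Finset.sum_le_sum (g := fun _ => (1 : ℝ)) fun j _ => ?_).trans_eq (by simp)
      split_ifs <;> norm_num
    have hwin : ∀ j : ℕ, (if q (U ω) < trainedScore X Y ntrain s ω
        (X (ntrain + ncal + 1 + j : ℕ) ω) (Y (ntrain + ncal + 1 + j : ℕ) ω)
        then (1 : ℝ) else 0) =
        A'.indicator (fun _ => (1 : ℝ)) (U ω, Z ((ntrain + ncal + 1 : ℕ) + j) ω) := by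
      intro j
      rw [Set.indicator_apply, ← Nat.cast_add]
      rfl
    simp_rw [hwin] at hcount hdrop
    rw [hbad', Set.mem_ofPred_eq, Finset.sum_sub_distrib, Finset.sum_const, Finset.card_range,
      nsmul_eq_mul, not_le, show ((2 * m' * a' : ℕ) : ℝ) = 2 * m' * a' by push_cast; rfl] at hω2
    have hu : (0 : ℝ) ≤ u := Nat.cast_nonneg u
    have hdev := deviation_le_mul hσ'.2.le hL' hm' hntestR (by linarith : 2 * m' * a' ≤ (ntest : ℝ))
    have hmean := mul_le_mul_of_nonneg_left (hAq' (U ω)) hN0'.le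
    have hmean' : 2 * m' * a' * (1 - p) ≤ ntest * (1 - p) :=
      mul_le_mul_of_nonneg_right (by linarith) (by linarith)
    have hε : sigmaTilde β a' * Real.sqrt (4 / ntest * L') + 1 / (3 * m') * L' =
        εtest - u / ntest := by rw [htest]; ring
    rw [hε, mul_sub, mul_div_cancel₀ _ hntestR.ne'] at hdev
    rw [Set.mem_ofPred_eq]
    refine le_of_mul_le_mul_left ?_ hntestR
    calc (ntest : ℝ) * (1 - α - (εcal + εtest)) = ntest - ntest * (1 - p) - ntest * εtest := by
          rw [hp]; ring
      _ ≤ _ := by linarith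
  calc 1 - δcal - δtest ≤ 1 - μ.real (bad ∪ bad') := by
        linarith [measureReal_union_le (μ := μ) bad bad']
    _ = μ.real (bad ∪ bad')ᶜ := (probReal_compl_eq_one_sub (hB.union hB')).symm
    _ ≤ _ := measureReal_mono hgood
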